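/- Let $p\ge 0$ be an integer, and let $dX=\prod_{i\le j}dx_{ij}$ denote Lebesgue measure on the real symmetric $p\times p$ matrices; $X>O$ means that $X$ is symmetric positive definite, $T>X$ means $T-X>O$, and $|X|=\det X$. Put $$\Gamma_p(z)=\pi^{p(p-1)/4}\prod_{j=0}^{p-1}\Gamma\!\left(z-\tfrac j2\right).$$ For a complex-valued function $g$ on the positive definite matrices let $$g^*(s)=M\{g;s\}=\int_{X>O}|X|^{s-\frac{p+1}{2}}g(X)\,dX$$ be its M-transform, which is said to exist at $s$ if this integral converges absolutely, and let $$({}_XW_\infty^{-\alpha}g)(X)=\frac1{\Gamma_p(\alpha)}\int_{T>X}|T-X|^{\alpha-\frac{p+1}{2}}g(T)\,dT$$ be its right-sided Weyl fractional integral of order $\alpha$. Let $\alpha,s\in\mathbb C$ with $\Re(\alpha)>\frac{p-1}{2}$ and $\Re(s)>\frac{p-1}{2}$, and let $f$ be a complex-valued function on the positive definite $p\times p$ matrices whose M-transform $f^*$ exists at $s$. Put $g(X)=|X|^{-\alpha}f(X)$. Then the integral defining ${}_XW_\infty^{-\alpha}g$ converges absolutely for almost every $X>O$, the M-transform of ${}_XW_\infty^{-\alpha}g$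 exists at $s$, and $$M\{{}_XW_\infty^{-\alpha}\,|X|^{-\alpha}f(X);\,s\}=\frac{\Gamma_p(s)}{\Gamma_p(\alpha+s)}\,f^*(s).$$ -/

import Mathlib

noncomputable section

open MeasureTheory

/-- Index set of the free coordinates `x i j`, `i ≤ j`, of a symmetric `p × p` matrix. -/
abbrev UpperIdx (p : ℕ) : Type := {ij : Fin p × Fin p // ij.1 ≤ ij.2}

/-- The symmetric matrix with prescribed entries on and above the diagonal. -/
def symmOfUpper (p : ℕ) (x : UpperIdx p → ℝ) : Matrix (Fin p) (Fin p) ℝ :=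
  Matrix.of fun i j => x ⟨(min i j, max i j), min_le_max⟩

/-- Real matrices carry the product (Borel) sigma-algebra of their entries. -/
instance instMeasurableSpaceRealMatrix (p : ℕ) : MeasurableSpace (Matrix (Fin p) (Fin p) ℝ) :=
  inferInstanceAs (MeasurableSpace (Fin p → Fin p → ℝ))

theorem measurable_symmOfUpper (p : ℕ) : Measurable (symmOfUpper p) := by
  refine measurable_pi_iff.2 fun i => measurable_pi_iff.2 fun j => ?_
  exact measurable_pi_apply _

/-- The measure `dX = ∏_{i ≤ j} dx i j` on real symmetric `p × p` matrices, regarded as a measure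
on all real `p × p` matrices that is carried by the symmetric ones. -/
def symmVolume (p : ℕ) : Measure (Matrix (Fin p) (Fin p) ℝ) :=
  Measure.map (symmOfUpper p) volume

/-- The cone `X > O` of real symmetric positive definite `p × p` matrices. -/
def posDefCone (p : ℕ) : Set (Matrix (Fin p) (Fin p) ℝ) := {X | X.PosDef}

/-- The real matrix-variate gamma function
`Γ_p(z) = π ^ (p (p - 1) / 4) Γ(z) Γ(z - 1/2) ⋯ Γ(z - (p - 1)/2)`. -/
def matrixGamma (p : ℕ) (z : ℂ) : ℂ :=
  (Real.pi : ℂ) ^ ((p : ℂ) * ((p : ℂ) - 1) / 4) *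
    ∏ j ∈ Finset.range p, Complex.Gamma (z - (j : ℂ) / 2)

/-- The integrand `|X| ^ (s - (p + 1)/2) f(X)` of the M-transform. -/
def mIntegrand {p : ℕ} (f : Matrix (Fin p) (Fin p) ℝ → ℂ) (s : ℂ)
    (X : Matrix (Fin p) (Fin p) ℝ) : ℂ :=
  (X.det : ℂ) ^ (s - ((p : ℂ) + 1) / 2) * f X

/-- The M-transform of `f` at `s` exists: its defining integral over `X > O` converges. -/
def MTransformExists {p : ℕ} (f : Matrix (Fin p) (Fin p) ℝ → ℂ) (s : ℂ) : Prop :=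
  IntegrableOn (mIntegrand f s) (posDefCone p) (symmVolume p)

/-- The M-transform `∫_{X > O} |X| ^ (s - (p + 1)/2) f(X) dX`. -/
def mTransform {p : ℕ} (f : Matrix (Fin p) (Fin p) ℝ → ℂ) (s : ℂ) : ℂ :=
  ∫ X in posDefCone p, mIntegrand f s X ∂(symmVolume p)

/-- The integrand `|T - X| ^ (α - (p + 1)/2) f(T)` of the right-sided Weyl integral at `X`. -/
def weylIntegrand {p : ℕ} (α : ℂ) (f : Matrix (Fin p) (Fin p) ℝ → ℂ)
    (X T : Matrix (Fin p) (Fin p) ℝ) : ℂ :=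
  ((T - X).det : ℂ) ^ (α - ((p : ℂ) + 1) / 2) * f T

/-- The right-sided Weyl integral of order `α` of `f` converges at `X`. -/
def WeylExistsAt {p : ℕ} (α : ℂ) (f : Matrix (Fin p) (Fin p) ℝ → ℂ)
    (X : Matrix (Fin p) (Fin p) ℝ) : Prop :=
  IntegrableOn (weylIntegrand α f X) {T | (T - X).PosDef} (symmVolume p)

/-- The right-sided Weyl fractional integral of order `α`,
`X ↦ (1 / Γ_p(α)) ∫_{T > X} |T - X| ^ (α - (p + 1)/2) f(T) dT`. -/
def weyl {p : ℕ} (α : ℂ) (f : Matrix (Fin p) (Fin p) ℝ → ℂ)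
    (X : Matrix (Fin p) (Fin p) ℝ) : ℂ :=
  1 / matrixGamma p α *
    ∫ T in {T | (T - X).PosDef}, weylIntegrand α f X T ∂(symmVolume p)

/-- The function `X ↦ |X| ^ (-α) f(X)`. -/
def detPowMul {p : ℕ} (α : ℂ) (f : Matrix (Fin p) (Fin p) ℝ → ℂ)
    (X : Matrix (Fin p) (Fin p) ℝ) : ℂ :=
  (X.det : ℂ) ^ (-α) * f X

end

noncomputable section

open MeasureTheory

/-! The transform of the Weyl integral is a double integral over O < X < T of |X|^(s-(p+1)/2)
|T-X|^(α-(p+1)/2) |T|^(-α) f(T), divided by Γ_p(α). Write |T|^(-α) f(T) as |T|^((p+1)/2-α-s) times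
the integrand F(T) of f^*(s), and integrate over X first. The remaining kernel `betaKernel` is
invariant under simultaneous congruence of X and T once the Jacobian is counted, so its X-integral
is a constant B, independent of T. The double integral is therefore B f^*(s), and the claim reduces
to the beta integral B = Γ_p(s) Γ_p(α) / Γ_p(s+α).

The invariance is `coneConv_eq`; it rests on the Jacobian |det A|^(p+1) of X ↦ A X Aᵀ
(`det_upperCongr`). The value of B (`coneConv_upperOne`) comes from computing Γ_p(s) Γ_p(α) as a
double integral of |X|^(s-(p+1)/2) |T-X|^(α-(p+1)/2) exp(-tr T). That uses the integral formula for
Γ_p (`gammaIntegrand_integral`), proved by induction on p with Schur complements.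

Absolute convergence follows from the same computation: the modulus of each kernel is the kernel
with real parts as parameters. Fubini then gives all three conclusions
(`integrable_betaKernel_mul`). -/

/-! ### Free coordinates on symmetric matrices -/

theorem symmOfUpper_apply_of_le {p : ℕ} (x : UpperIdx p → ℝ) {i j : Fin p} (h : i ≤ j) :
    symmOfUpper p x i j = x ⟨(i, j), h⟩ := by
  simp [symmOfUpper, min_eq_left h, max_eq_right h]

theorem symmOfUpper_isSymm {p : ℕ} (x : UpperIdx p → ℝ) : (symmOfUpper p x).IsSymm := by
  ext i j
  simp [symmOfUpper, min_comm, max_comm]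

/-- The entries on and above the diagonal. -/
def upperPart (p : ℕ) (M : Matrix (Fin p) (Fin p) ℝ) : UpperIdx p → ℝ := fun ij => M ij.1.1 ij.1.2

theorem measurable_upperPart (p : ℕ) : Measurable (upperPart p) :=
  measurable_pi_iff.2 fun ij =>
    (measurable_pi_apply ij.1.2).comp (measurable_pi_apply (X := fun _ => Fin p → ℝ) ij.1.1)

theorem upperPart_symmOfUpper {p : ℕ} (x : UpperIdx p → ℝ) : upperPart p (symmOfUpper p x) = x := by
  ext ⟨⟨i, j⟩, h⟩
  exact symmOfUpper_apply_of_le x h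

theorem symmOfUpper_upperPart {p : ℕ} {M : Matrix (Fin p) (Fin p) ℝ} (hM : M.IsSymm) :
    symmOfUpper p (upperPart p M) = M := by
  ext i j
  rcases le_total i j with h | h
  · simp [symmOfUpper_apply_of_le _ h, upperPart]
  · rw [← (symmOfUpper_isSymm _).apply, symmOfUpper_apply_of_le _ h]
    exact hM.apply _ _

theorem symmOfUpper_injective (p : ℕ) : Function.Injective (symmOfUpper p) :=
  Function.LeftInverse.injective upperPart_symmOfUpper

theorem range_symmOfUpper (p : ℕ) : Set.range (symmOfUpper p) = {M | M.IsSymm} := by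
  ext M
  exact ⟨fun ⟨x, hx⟩ => hx ▸ symmOfUpper_isSymm x, fun h => ⟨_, symmOfUpper_upperPart h⟩⟩

theorem measurable_matrix_entry {p : ℕ} (i j : Fin p) :
    Measurable fun M : Matrix (Fin p) (Fin p) ℝ => M i j :=
  (measurable_pi_apply j).comp (measurable_pi_apply (X := fun _ => Fin p → ℝ) i)

/-- Integrals against a pushforward along a measurable embedding transfer to the source with no
measurability condition on the integrand; this matters because `f` is arbitrary off the cone. -/
theorem measurableEmbedding_symmOfUpper (p : ℕ) : MeasurableEmbedding (symmOfUpper p) := by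
  refine MeasurableEmbedding.of_measurable_inverse (measurable_symmOfUpper p) ?_
    (measurable_upperPart p) upperPart_symmOfUpper
  rw [range_symmOfUpper]
  have : {M : Matrix (Fin p) (Fin p) ℝ | M.IsSymm} = ⋂ i, ⋂ j, {M | M j i = M i j} := by
    ext M
    simp [Matrix.IsSymm.ext_iff]
  rw [this]
  exact MeasurableSet.iInter fun i => MeasurableSet.iInter fun j =>
    measurableSet_eq_fun (measurable_matrix_entry j i) (measurable_matrix_entry i j)

theorem symmOfUpper_add {p : ℕ} (x y : UpperIdx p → ℝ) :
    symmOfUpper p (x + y) = symmOfUpper p x + symmOfUpper p y := rfl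

theorem symmOfUpper_sub {p : ℕ} (x y : UpperIdx p → ℝ) :
    symmOfUpper p (x - y) = symmOfUpper p x - symmOfUpper p y := rfl

theorem symmOfUpper_smul {p : ℕ} (c : ℝ) (x : UpperIdx p → ℝ) :
    symmOfUpper p (c • x) = c • symmOfUpper p x := rfl

/-! ### The Jacobian of a congruence -/

/-- The congruence `X ↦ A X Aᵀ` in the free coordinates of a symmetric matrix. -/
def upperCongr {p : ℕ} (A : Matrix (Fin p) (Fin p) ℝ) :
    (UpperIdx p → ℝ) →ₗ[ℝ] (UpperIdx p → ℝ) where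
  toFun x := upperPart p (A * symmOfUpper p x * A.transpose)
  map_add' x y := by
    rw [symmOfUpper_add, mul_add, add_mul]
    rfl
  map_smul' c x := by
    rw [symmOfUpper_smul, Matrix.mul_smul, Matrix.smul_mul]
    rfl

theorem symmOfUpper_upperCongr {p : ℕ} (A : Matrix (Fin p) (Fin p) ℝ) (x : UpperIdx p → ℝ) :
    symmOfUpper p (upperCongr A x) = A * symmOfUpper p x * A.transpose := by
  refine symmOfUpper_upperPart (M := A * symmOfUpper p x * A.transpose) ?_
  rw [Matrix.IsSymm, Matrix.transpose_mul, Matrix.transpose_mul, Matrix.transpose_transpose,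
    (symmOfUpper_isSymm x).eq, mul_assoc]

theorem upperCongr_mul {p : ℕ} (A B : Matrix (Fin p) (Fin p) ℝ) :
    upperCongr (A * B) = upperCongr A ∘ₗ upperCongr B := by
  refine LinearMap.ext fun x => symmOfUpper_injective p ?_
  simp only [LinearMap.comp_apply, symmOfUpper_upperCongr, Matrix.transpose_mul, mul_assoc]

theorem upperCongr_one {p : ℕ} :
    upperCongr (1 : Matrix (Fin p) (Fin p) ℝ) = LinearMap.id := by
  refine LinearMap.ext fun x => symmOfUpper_injective p ?_
  simp [symmOfUpper_upperCongr]

theorem det_upperCongr_mul {p : ℕ} (A B : Matrix (Fin p) (Fin p) ℝ) :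
    LinearMap.det (upperCongr (A * B)) =
      LinearMap.det (upperCongr A) * LinearMap.det (upperCongr B) := by
  rw [upperCongr_mul, LinearMap.det_comp]

/-- The index i occurs p - i times as a row and i + 1 times as a column (counting from 0), hence p +
1 times in all. -/
theorem prod_upperIdx {p : ℕ} (d : Fin p → ℝ) :
    ∏ ij : UpperIdx p, d ij.1.1 * d ij.1.2 = (∏ i, d i) ^ (p + 1) := by
  have h : ∏ ij : UpperIdx p, d ij.1.1 * d ij.1.2 =
      ∏ i, ∏ j, if i ≤ j then d i * d j else 1 := by
    rw [← Finset.prod_subtype (Finset.univ.filter fun ij : Fin p × Fin p => ij.1 ≤ ij.2)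
      (by simp) (fun ij : Fin p × Fin p => d ij.1 * d ij.2), Finset.prod_filter,
      ← Finset.univ_product_univ, Finset.prod_product]
  have h2 : ∀ i j : Fin p, (if i ≤ j then d i * d j else 1) =
      (if i ≤ j then d i else 1) * (if i ≤ j then d j else 1) := by
    intro i j
    split_ifs <;> simp
  simp only [h, h2, Finset.prod_mul_distrib]
  rw [Finset.prod_comm (f := fun i j => if i ≤ j then d j else 1), ← Finset.prod_mul_distrib,
    ← Finset.prod_pow]
  refine Finset.prod_congr rfl fun i _ => ?_
  rw [← Finset.prod_filter, ← Finset.prod_filter, Finset.prod_const, Finset.prod_const, ← pow_add]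
  congr 1
  rw [Finset.filter_le_eq_Ici, Finset.filter_ge_eq_Iic, Fin.card_Ici, Fin.card_Iic]
  omega

theorem det_upperCongr_diagonal {p : ℕ} (d : Fin p → ℝ) :
    LinearMap.det (upperCongr (Matrix.diagonal d)) = (∏ i, d i) ^ (p + 1) := by
  have : upperCongr (Matrix.diagonal d) =
      Matrix.toLin' (Matrix.diagonal fun ij : UpperIdx p => d ij.1.1 * d ij.1.2) := by
    refine LinearMap.ext fun x => ?_
    ext ⟨⟨i, j⟩, h⟩
    simp only [upperCongr, upperPart, LinearMap.coe_mk, AddHom.coe_mk, Matrix.diagonal_transpose,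
      Matrix.mul_diagonal, Matrix.diagonal_mul, symmOfUpper_apply_of_le x h, Matrix.toLin'_apply,
      Matrix.mulVec_diagonal]
    ring
  rw [this, LinearMap.det_toLin', Matrix.det_diagonal, prod_upperIdx]

theorem det_upperCongr_ne_zero {p : ℕ} {A : Matrix (Fin p) (Fin p) ℝ} (hA : A.det ≠ 0) :
    LinearMap.det (upperCongr A) ≠ 0 := by
  have h : LinearMap.det (upperCongr A) * LinearMap.det (upperCongr A⁻¹) = 1 := by
    rw [← det_upperCongr_mul, Matrix.mul_nonsing_inv _ (isUnit_iff_ne_zero.2 hA), upperCongr_one,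
      LinearMap.det_id]
  exact left_ne_zero_of_mul_eq_one h

/-- Doubling coordinate i by a diagonal D conjugates the transvection T into T², so its Jacobian J
satisfies J = J²; being nonzero, J is 1. -/
theorem det_upperCongr_transvection {p : ℕ} {i j : Fin p} (hij : i ≠ j) (c : ℝ) :
    LinearMap.det (upperCongr (Matrix.transvection i j c)) = 1 := by
  let D : Matrix (Fin p) (Fin p) ℝ := Matrix.diagonal (Function.update 1 i 2)
  have hD : D.det ≠ 0 := by
    rw [Matrix.det_diagonal]
    refine Finset.prod_ne_zero_iff.2 fun k _ => ?_
    by_cases hk : k = i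
    · subst hk; simp
    · simp [Function.update_of_ne hk]
  have hcomm : D * Matrix.transvection i j c =
      Matrix.transvection i j c * Matrix.transvection i j c * D := by
    rw [Matrix.transvection_mul_transvection_same (h := hij)]
    ext a b
    simp only [D, Matrix.diagonal_mul, Matrix.mul_diagonal, Matrix.transvection, Matrix.add_apply,
      Matrix.one_apply, Matrix.single_apply, Function.update_apply]
    by_cases ha : a = i <;> by_cases hb : b = j <;> by_cases hab : a = b <;>
      simp_all <;> grind
  have h := congrArg (fun M => LinearMap.det (upperCongr M)) hcomm
  simp only [det_upperCongr_mul] at h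
  have h1 := det_upperCongr_ne_zero hD
  have h2 : LinearMap.det (upperCongr (Matrix.transvection i j c)) ≠ 0 :=
    det_upperCongr_ne_zero (by simp [Matrix.det_transvection_of_ne i j hij])
  refine mul_right_cancel₀ (mul_ne_zero h1 h2) ?_
  linear_combination -h

/-- Both sides are multiplicative, and diagonal matrices and transvections generate the invertible
matrices. -/
theorem det_upperCongr {p : ℕ} {A : Matrix (Fin p) (Fin p) ℝ} (hA : A.det ≠ 0) :
    LinearMap.det (upperCongr A) = A.det ^ (p + 1) := by
  refine Matrix.diagonal_transvection_induction_of_det_ne_zero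
    (fun A => LinearMap.det (upperCongr A) = A.det ^ (p + 1)) A hA ?_ ?_ ?_
  · intro D _
    rw [det_upperCongr_diagonal, Matrix.det_diagonal]
  · intro t
    rw [Matrix.TransvectionStruct.toMatrix, det_upperCongr_transvection t.hij,
      Matrix.det_transvection_of_ne _ _ t.hij, one_pow]
  · intro A B _ _ hA hB
    rw [det_upperCongr_mul, hA, hB, Matrix.det_mul, mul_pow]

/-! ### The cone and its power kernels -/

/-- The positive definite cone in free coordinates. -/
def upperCone (p : ℕ) : Set (UpperIdx p → ℝ) := {x | (symmOfUpper p x).PosDef}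

theorem measurable_det_matrix (p : ℕ) :
    Measurable fun M : Matrix (Fin p) (Fin p) ℝ => M.det := by
  simp only [Matrix.det_apply]
  refine Finset.measurable_fun_sum _ fun σ _ => Measurable.const_smul ?_ _
  exact Finset.measurable_fun_prod _ fun i _ => measurable_matrix_entry _ _

theorem measurable_trace_matrix (p : ℕ) :
    Measurable fun M : Matrix (Fin p) (Fin p) ℝ => M.trace := by
  simp only [Matrix.trace, Matrix.diag]
  exact Finset.measurable_fun_sum _ fun i _ => measurable_matrix_entry _ _

theorem measurableSet_setOf_posSemidef (p : ℕ) :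
    MeasurableSet {x : UpperIdx p → ℝ | (symmOfUpper p x).PosSemidef} := by
  have h : {x : UpperIdx p → ℝ | (symmOfUpper p x).PosSemidef} =
      ⋂ v : Fin p → ℝ, {x | 0 ≤ v ⬝ᵥ (symmOfUpper p x).mulVec v} := by
    ext x
    simp only [Matrix.posSemidef_iff_dotProduct_mulVec, Set.mem_ofPred_eq, Set.mem_iInter]
    exact ⟨fun h => h.2, fun h => ⟨symmOfUpper_isSymm x, h⟩⟩
  rw [h]
  refine (isClosed_iInter fun v => ?_).measurableSet
  refine isClosed_le continuous_const ?_
  simp only [dotProduct, Matrix.mulVec, symmOfUpper, Matrix.of_apply]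
  fun_prop

theorem measurableSet_upperCone (p : ℕ) : MeasurableSet (upperCone p) := by
  have h : upperCone p = {x | (symmOfUpper p x).PosSemidef} ∩
      {x | (symmOfUpper p x).det = 0}ᶜ := by
    ext x
    exact ⟨fun h => ⟨Matrix.PosDef.posSemidef h, (Matrix.PosDef.det_pos h).ne'⟩,
      fun h => (h.1.posDef_iff_det_ne_zero).2 h.2⟩
  rw [h]
  exact (measurableSet_setOf_posSemidef p).inter (measurableSet_eq_fun
    ((measurable_det_matrix p).comp (measurable_symmOfUpper p)) measurable_const).compl

theorem upperCone_add {p : ℕ} {x y : UpperIdx p → ℝ} (hx : x ∈ upperCone p) (hy : y ∈ upperCone p) :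
    x + y ∈ upperCone p :=
  Matrix.PosDef.add hx hy

theorem mem_upperCone_upperCongr {p : ℕ} {A : Matrix (Fin p) (Fin p) ℝ} (hA : A.det ≠ 0)
    (x : UpperIdx p → ℝ) : upperCongr A x ∈ upperCone p ↔ x ∈ upperCone p := by
  simp only [upperCone, Set.mem_ofPred_eq, symmOfUpper_upperCongr]
  have := Matrix.IsUnit.posDef_star_right_conjugate_iff (x := symmOfUpper p x)
    ((Matrix.isUnit_iff_isUnit_det A).2 (isUnit_iff_ne_zero.2 hA))
  rwa [Matrix.star_eq_conjTranspose, Matrix.conjTranspose_eq_transpose_of_trivial] at this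

/-- The function `|X| ^ (a - (p + 1)/2)` on the cone, extended by zero. -/
def coneKernel (p : ℕ) (a : ℂ) : (UpperIdx p → ℝ) → ℂ :=
  (upperCone p).indicator fun x => ((symmOfUpper p x).det : ℂ) ^ (a - ((p : ℂ) + 1) / 2)

theorem coneKernel_of_mem {p : ℕ} (a : ℂ) {x : UpperIdx p → ℝ} (hx : x ∈ upperCone p) :
    coneKernel p a x = ((symmOfUpper p x).det : ℂ) ^ (a - ((p : ℂ) + 1) / 2) :=
  Set.indicator_of_mem hx _

theorem coneKernel_of_notMem {p : ℕ} (a : ℂ) {x : UpperIdx p → ℝ} (hx : x ∉ upperCone p) :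
    coneKernel p a x = 0 :=
  Set.indicator_of_notMem hx _

theorem coneKernel_ne_zero {p : ℕ} (a : ℂ) {x : UpperIdx p → ℝ} (hx : x ∈ upperCone p) :
    coneKernel p a x ≠ 0 := by
  rw [coneKernel_of_mem a hx, Ne, Complex.cpow_eq_zero_iff]
  exact fun h => (Matrix.PosDef.det_pos hx).ne' (by exact_mod_cast h.1)

theorem measurable_coneKernel (p : ℕ) (a : ℂ) : Measurable (coneKernel p a) := by
  refine Measurable.indicator ?_ (measurableSet_upperCone p)
  exact (Complex.measurable_ofReal.comp ((measurable_det_matrix p).comp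
    (measurable_symmOfUpper p))).pow_const _

/-- This reduces absolute convergence to the complex formulas at real parameters; the norm is cast
to ℂ so that those formulas apply directly. -/
theorem norm_coneKernel {p : ℕ} (a : ℂ) (x : UpperIdx p → ℝ) :
    (‖coneKernel p a x‖ : ℂ) = coneKernel p (a.re : ℂ) x := by
  by_cases hx : x ∈ upperCone p
  · have hd : 0 < (symmOfUpper p x).det := Matrix.PosDef.det_pos hx
    rw [coneKernel_of_mem _ hx, coneKernel_of_mem _ hx, Complex.norm_cpow_eq_rpow_re_of_pos hd,
      Complex.ofReal_cpow hd.le]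
    congr 1
    simp
  · simp [coneKernel_of_notMem _ hx]

theorem coneKernel_upperCongr {p : ℕ} {A : Matrix (Fin p) (Fin p) ℝ} (hA : A.det ≠ 0) (a : ℂ)
    (x : UpperIdx p → ℝ) : coneKernel p a (upperCongr A x) =
      ((A.det * A.det : ℝ) : ℂ) ^ (a - ((p : ℂ) + 1) / 2) * coneKernel p a x := by
  by_cases hx : x ∈ upperCone p
  · rw [coneKernel_of_mem a hx, coneKernel_of_mem a ((mem_upperCone_upperCongr hA x).2 hx),
      symmOfUpper_upperCongr, ← Complex.mul_cpow_ofReal_nonneg (mul_self_nonneg _)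
        (Matrix.PosDef.det_pos hx).le, Matrix.det_mul, Matrix.det_mul, Matrix.det_transpose]
    congr 1
    push_cast
    ring
  · rw [coneKernel_of_notMem a hx,
      coneKernel_of_notMem a (fun h => hx ((mem_upperCone_upperCongr hA x).1 h)), mul_zero]

/-- The coordinates of the identity matrix. -/
def upperOne (p : ℕ) : UpperIdx p → ℝ := upperPart p 1

theorem symmOfUpper_upperOne (p : ℕ) : symmOfUpper p (upperOne p) = 1 :=
  symmOfUpper_upperPart Matrix.isSymm_one

/-- Congruences act transitively on the cone: factor t as BᵀB and take A = Bᵀ. -/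
theorem exists_upperCongr_upperOne {p : ℕ} {t : UpperIdx p → ℝ} (ht : t ∈ upperCone p) :
    ∃ A : Matrix (Fin p) (Fin p) ℝ, A.det ≠ 0 ∧ A.det * A.det = (symmOfUpper p t).det ∧
      upperCongr A (upperOne p) = t := by
  open scoped MatrixOrder in
  obtain ⟨B, hB⟩ := CStarAlgebra.nonneg_iff_eq_star_mul_self.mp (Matrix.PosDef.posSemidef ht).nonneg
  rw [Matrix.star_eq_conjTranspose, Matrix.conjTranspose_eq_transpose_of_trivial] at hB
  have hd : B.det * B.det = (symmOfUpper p t).det := by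
    rw [hB, Matrix.det_mul, Matrix.det_transpose]
  refine ⟨B.transpose, ?_, by rwa [Matrix.det_transpose], ?_⟩
  · rw [Matrix.det_transpose]
    intro h
    exact (Matrix.PosDef.det_pos ht).ne' (by rw [← hd, h, zero_mul])
  · refine symmOfUpper_injective p ?_
    rw [symmOfUpper_upperCongr, symmOfUpper_upperOne, Matrix.transpose_transpose, mul_one, hB]

/-! ### Homogeneity of the convolution -/

/-- The convolution of two cone kernels. -/
def coneConv (p : ℕ) (a b : ℂ) (t : UpperIdx p → ℝ) : ℂ :=
  ∫ x, coneKernel p a x * coneKernel p b (t - x)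

theorem coneConv_of_notMem {p : ℕ} (a b : ℂ) {t : UpperIdx p → ℝ} (ht : t ∉ upperCone p) :
    coneConv p a b t = 0 := by
  rw [coneConv]
  refine integral_eq_zero_of_ae (Filter.Eventually.of_forall fun x => ?_)
  by_cases hx : x ∈ upperCone p
  · have : t - x ∉ upperCone p := fun h => ht (by simpa using upperCone_add hx h)
    simp [coneKernel_of_notMem _ this]
  · simp [coneKernel_of_notMem _ hx]

theorem integral_upperCongr {p : ℕ} {A : Matrix (Fin p) (Fin p) ℝ} (hA : A.det ≠ 0)
    {g : (UpperIdx p → ℝ) → ℂ} (hg : Measurable g) :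
    ∫ x, g x = ((|A.det| ^ (p + 1) : ℝ) : ℂ) * ∫ x, g (upperCongr A x) := by
  have hL := det_upperCongr_ne_zero hA
  have hm : Measurable (upperCongr A) :=
    (LinearMap.continuous_of_finiteDimensional (upperCongr A)).measurable
  have h := integral_map (μ := volume) hm.aemeasurable
    (hg.aestronglyMeasurable (μ := Measure.map (upperCongr A) volume))
  rw [Measure.map_linearMap_addHaar_eq_smul_addHaar _ hL, integral_smul_measure,
    det_upperCongr hA, ENNReal.toReal_ofReal (abs_nonneg _), abs_inv, abs_pow] at h
  have h0 : |A.det| ^ (p + 1) ≠ 0 := pow_ne_zero _ (abs_ne_zero.2 hA)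
  rw [← h, Complex.real_smul, ← mul_assoc, ← Complex.ofReal_mul, mul_inv_cancel₀ h0,
    Complex.ofReal_one, one_mul]

/-- Substitute x = A y Aᵀ with t = A Aᵀ. The powers of |det A| add up to (p+1) + (2a-(p+1)) +
(2b-(p+1)) = 2(a+b)-(p+1). No convergence is needed, since the change of variables also respects the
default value 0 of a divergent integral. -/
theorem coneConv_eq {p : ℕ} (a b : ℂ) {t : UpperIdx p → ℝ} (ht : t ∈ upperCone p) :
    coneConv p a b t = coneConv p a b (upperOne p) * coneKernel p (a + b) t := by
  obtain ⟨A, hA, hdet, rfl⟩ := exists_upperCongr_upperOne ht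
  rw [coneKernel_of_mem _ ht, ← hdet, coneConv, integral_upperCongr hA (by
    exact (measurable_coneKernel p a).mul
      ((measurable_coneKernel p b).comp (measurable_const.sub measurable_id)))]
  simp only [← map_sub, coneKernel_upperCongr hA]
  rw [coneConv]
  have hr : 0 < |A.det| := abs_pos.2 hA
  have hr' : ((|A.det| : ℝ) : ℂ) ≠ 0 := by exact_mod_cast hr.ne'
  have key : ((|A.det| ^ (p + 1) : ℝ) : ℂ) *
      (((A.det * A.det : ℝ) : ℂ) ^ (a - ((p : ℂ) + 1) / 2) *
        ((A.det * A.det : ℝ) : ℂ) ^ (b - ((p : ℂ) + 1) / 2)) =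
      ((A.det * A.det : ℝ) : ℂ) ^ (a + b - ((p : ℂ) + 1) / 2) := by
    rw [← abs_mul_abs_self A.det, Complex.ofReal_pow, Complex.ofReal_mul]
    simp only [Complex.mul_cpow_ofReal_nonneg hr.le hr.le]
    rw [← Complex.cpow_natCast]
    simp only [← Complex.cpow_add _ _ hr']
    congr 1
    push_cast
    ring
  rw [← key]
  simp only [mul_mul_mul_comm _ (coneKernel p a _), integral_const_mul]
  ring

/-! ### Splitting off the first row: blocks and Schur complements -/

/-- The free coordinates of a symmetric matrix, split into the corner, the first row
and the remaining block. -/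
def upperIdxSucc (p : ℕ) : (Unit ⊕ Fin p) ⊕ UpperIdx p ≃ UpperIdx (p + 1) :=
  Equiv.ofBijective
    (Sum.elim (Sum.elim (fun _ => ⟨(0, 0), le_rfl⟩) fun j => ⟨(0, j.succ), Fin.zero_le _⟩)
      fun ij => ⟨(ij.1.1.succ, ij.1.2.succ), Fin.succ_le_succ_iff.2 ij.2⟩) <| by
    constructor
    · rintro ((⟨⟩ | i) | ⟨⟨i, j⟩, h⟩) ((⟨⟩ | k) | ⟨⟨k, l⟩, h'⟩) hh <;>
        simp_all [Subtype.ext_iff, Prod.ext_iff, Fin.succ_ne_zero, (Fin.succ_ne_zero _).symm]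
    · rintro ⟨⟨i, j⟩, h⟩
      induction i using Fin.cases with
      | zero =>
        induction j using Fin.cases with
        | zero => exact ⟨Sum.inl (Sum.inl ()), rfl⟩
        | succ j => exact ⟨Sum.inl (Sum.inr j), rfl⟩
      | succ i =>
        induction j using Fin.cases with
        | zero => exact absurd h (by simp)
        | succ j => exact ⟨Sum.inr ⟨(i, j), Fin.succ_le_succ_iff.1 h⟩, rfl⟩

/-- Assembling a symmetric matrix from its corner, first row and remaining block. -/
def blockUpper (p : ℕ) (z : (ℝ × (Fin p → ℝ)) × (UpperIdx p → ℝ)) : UpperIdx (p + 1) → ℝ :=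
  fun k => Sum.elim (Sum.elim (fun _ => z.1.1) z.1.2) z.2 ((upperIdxSucc p).symm k)

theorem blockUpper_upperIdxSucc (p : ℕ) (z : (ℝ × (Fin p → ℝ)) × (UpperIdx p → ℝ))
    (k : (Unit ⊕ Fin p) ⊕ UpperIdx p) :
    blockUpper p z (upperIdxSucc p k) = Sum.elim (Sum.elim (fun _ => z.1.1) z.1.2) z.2 k := by
  simp [blockUpper]

theorem measurePreserving_blockUpper (p : ℕ) : MeasurePreserving (blockUpper p) := by
  have h1 : MeasurePreserving (MeasurableEquiv.funUnique Unit ℝ).symm :=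
    (volume_preserving_funUnique Unit ℝ).symm _
  have h2 := volume_measurePreserving_sumPiEquivProdPi_symm (fun _ : Unit ⊕ Fin p => ℝ)
  have h3 := volume_measurePreserving_sumPiEquivProdPi_symm
    (fun _ : (Unit ⊕ Fin p) ⊕ UpperIdx p => ℝ)
  have h4 := volume_preserving_arrowCongr' (upperIdxSucc p) (MeasurableEquiv.refl ℝ)
    (MeasurePreserving.id volume)
  have h5 : MeasurePreserving (Prod.map (MeasurableEquiv.funUnique Unit ℝ).symm
    (id : (Fin p → ℝ) → _)) := h1.prod (MeasurePreserving.id volume)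
  have h6 := ((h2.comp h5).prod (MeasurePreserving.id (volume : Measure (UpperIdx p → ℝ))))
  have h7 := h4.comp (h3.comp h6)
  convert h7 using 1
  swap
  · rfl
  funext z k
  obtain ⟨k, rfl⟩ := (upperIdxSucc p).surjective k
  rw [blockUpper_upperIdxSucc]
  simp only [MeasurableEquiv.arrowCongr', Equiv.arrowCongr', Equiv.arrowCongr, Function.comp_apply,
    MeasurableEquiv.coe_mk, Equiv.coe_fn_mk, Equiv.symm_apply_apply]
  rcases k with (k | k) | k <;> rfl

theorem symmOfUpper_blockUpper (p : ℕ) (x : ℝ) (v : Fin p → ℝ) (W : UpperIdx p → ℝ)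
    (e : Fin (p + 1) ≃ Unit ⊕ Fin p) (he : e = (finSuccEquiv p).trans
      ((Equiv.optionEquivSumPUnit (Fin p)).trans (Equiv.sumComm _ _))) :
    symmOfUpper (p + 1) (blockUpper p ((x, v), W)) =
      (Matrix.fromBlocks (Matrix.diagonal fun _ => x) (Matrix.of fun _ j => v j)
        (Matrix.of fun i _ => v i) (symmOfUpper p W)).submatrix e e := by
  have e0 : e 0 = Sum.inl () := by subst he; simp
  have es : ∀ i : Fin p, e i.succ = Sum.inr i := by intro i; subst he; simp
  have key : ∀ i j, i ≤ j → symmOfUpper (p + 1) (blockUpper p ((x, v), W)) i j =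
      (Matrix.fromBlocks (Matrix.diagonal fun _ => x) (Matrix.of fun _ j => v j)
        (Matrix.of fun i _ => v i) (symmOfUpper p W)).submatrix e e i j := by
    intro i j h
    rw [symmOfUpper_apply_of_le _ h]
    induction i using Fin.cases with
    | zero =>
      induction j using Fin.cases with
      | zero =>
        rw [show (⟨(0, 0), h⟩ : UpperIdx (p + 1)) = upperIdxSucc p (Sum.inl (Sum.inl ())) from rfl,
          blockUpper_upperIdxSucc]
        simp [e0]
      | succ j =>
        rw [show (⟨(0, j.succ), h⟩ : UpperIdx (p + 1)) = upperIdxSucc p (Sum.inl (Sum.inr j))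
          from rfl, blockUpper_upperIdxSucc]
        simp [e0, es]
    | succ i =>
      induction j using Fin.cases with
      | zero => exact absurd h (by simp)
      | succ j =>
        have h' := Fin.succ_le_succ_iff.1 h
        rw [show (⟨(i.succ, j.succ), h⟩ : UpperIdx (p + 1)) =
          upperIdxSucc p (Sum.inr ⟨(i, j), h'⟩) from rfl, blockUpper_upperIdxSucc]
        simp [es, symmOfUpper_apply_of_le W h']
  have hsymm : ((Matrix.fromBlocks (Matrix.diagonal fun _ => x) (Matrix.of fun _ j => v j)
        (Matrix.of fun i _ => v i) (symmOfUpper p W)).submatrix e e).IsSymm := by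
    refine Matrix.IsSymm.submatrix (Matrix.IsSymm.fromBlocks (Matrix.isSymm_diagonal _) ?_
      (symmOfUpper_isSymm W)) e
    rfl
  ext i j
  rcases le_total i j with h | h
  · exact key i j h
  · rw [← (symmOfUpper_isSymm _).apply, key j i h]
    exact hsymm.apply _ _

/-- The shear that replaces the lower block by its Schur complement. -/
def schurShear (p : ℕ) (z : (ℝ × (Fin p → ℝ)) × (UpperIdx p → ℝ)) :
    (ℝ × (Fin p → ℝ)) × (UpperIdx p → ℝ) :=
  (z.1, upperPart p (Matrix.of fun i j => z.1.2 i * z.1.2 j / z.1.1) + z.2)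

/-- For each fixed corner and row the shear is a translation of the remaining block. -/
theorem measurePreserving_schurShear (p : ℕ) : MeasurePreserving (schurShear p) := by
  refine (MeasurePreserving.id _).skew_product (g := fun (a : ℝ × (Fin p → ℝ)) W =>
    upperPart p (Matrix.of fun i j => a.2 i * a.2 j / a.1) + W) ?_
    (Filter.Eventually.of_forall fun a => (measurePreserving_add_left volume _).map_eq)
  refine measurable_pi_iff.2 fun ij => ?_
  simp only [Function.uncurry, upperPart, Pi.add_apply, Matrix.of_apply]
  fun_prop

/-- The lower block is chosen so that the Schur complement of the corner x is exactly W. -/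
theorem posDef_fromBlocks_schur {p : ℕ} {x : ℝ} (hx : 0 < x) (v : Fin p → ℝ)
    (W : Matrix (Fin p) (Fin p) ℝ) :
    (Matrix.fromBlocks (Matrix.diagonal fun _ : Unit => x) (Matrix.of fun _ j => v j)
        (Matrix.of fun i _ => v i) ((Matrix.of fun i j => v i * v j / x) + W)).det = x * W.det ∧
    ((Matrix.fromBlocks (Matrix.diagonal fun _ : Unit => x) (Matrix.of fun _ j => v j)
        (Matrix.of fun i _ => v i) ((Matrix.of fun i j => v i * v j / x) + W)).PosDef ↔
      W.PosDef) := by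
  have hA : (Matrix.diagonal fun _ : Unit => x).PosDef := Matrix.PosDef.diagonal fun _ => hx
  have hinv : (Matrix.diagonal fun _ : Unit => x) * (Matrix.diagonal fun _ : Unit => x⁻¹) = 1 := by
    rw [Matrix.diagonal_mul_diagonal]
    simp [hx.ne']
  let : Invertible (Matrix.diagonal fun _ : Unit => x) :=
    ⟨_, mul_eq_one_comm.1 hinv, hinv⟩
  have hS : ((Matrix.of fun i j => v i * v j / x) + W) -
      (Matrix.of fun (i : Fin p) (_ : Unit) => v i) * (Matrix.diagonal fun _ : Unit => x⁻¹) *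
        (Matrix.of fun (_ : Unit) j => v j) = W := by
    ext i j
    simp [Matrix.mul_apply]
    ring
  have hdet : (Matrix.fromBlocks (Matrix.diagonal fun _ : Unit => x) (Matrix.of fun _ j => v j)
        (Matrix.of fun i _ => v i) ((Matrix.of fun i j => v i * v j / x) + W)).det =
      x * W.det := by
    rw [Matrix.det_fromBlocks₁₁, invOf_eq_right_inv hinv, hS]
    simp
  refine ⟨hdet, ?_⟩
  have hpsd : (Matrix.fromBlocks (Matrix.diagonal fun _ : Unit => x) (Matrix.of fun _ j => v j)
        (Matrix.of fun i _ => v i) ((Matrix.of fun i j => v i * v j / x) + W)).PosSemidef ↔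
      W.PosSemidef := by
    have := Matrix.PosDef.fromBlocks₁₁ (Matrix.of fun (_ : Unit) j => v j)
      ((Matrix.of fun i j => v i * v j / x) + W) hA
    rw [Matrix.inv_eq_right_inv hinv] at this
    have hc : (Matrix.of fun (_ : Unit) j => v j).conjTranspose =
        Matrix.of fun (i : Fin p) (_ : Unit) => v i := by
      ext; simp
    rwa [hc, hS] at this
  -- The Schur criterion is for semidefiniteness; a nonzero determinant upgrades it to definiteness
  -- in both directions.
  constructor
  · intro h
    exact (hpsd.1 h.posSemidef).posDef_iff_det_ne_zero.2 fun h0 => h.det_pos.ne' (by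
      rw [hdet, h0, mul_zero])
  · intro h
    refine (hpsd.2 h.posSemidef).posDef_iff_det_ne_zero.2 ?_
    rw [hdet]
    exact (mul_pos hx h.det_pos).ne'

/-! ### The integral formula for the matrix gamma function -/

theorem matrixGamma_zero (a : ℂ) : matrixGamma 0 a = 1 := by
  simp [matrixGamma]

theorem matrixGamma_succ (p : ℕ) (a : ℂ) :
    matrixGamma (p + 1) a =
      (Real.pi : ℂ) ^ ((p : ℂ) / 2) * Complex.Gamma a * matrixGamma p (a - 1 / 2) := by
  have hpi : (Real.pi : ℂ) ≠ 0 := by exact_mod_cast Real.pi_ne_zero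
  rw [matrixGamma, matrixGamma, Finset.prod_range_succ',
    show ((p + 1 : ℕ) : ℂ) * (((p + 1 : ℕ) : ℂ) - 1) / 4 =
      (p : ℂ) / 2 + (p : ℂ) * ((p : ℂ) - 1) / 4 by push_cast; ring, Complex.cpow_add _ _ hpi]
  have h : ∀ j : ℕ, a - ((j + 1 : ℕ) : ℂ) / 2 = a - 1 / 2 - (j : ℂ) / 2 := by
    intro j
    push_cast
    ring
  simp only [h, Nat.cast_zero, zero_div, sub_zero]
  ring

theorem matrixGamma_ne_zero {p : ℕ} {a : ℂ} (ha : ∀ j < p, (j : ℝ) / 2 < a.re) :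
    matrixGamma p a ≠ 0 := by
  have hpi : (Real.pi : ℂ) ≠ 0 := by exact_mod_cast Real.pi_ne_zero
  refine mul_ne_zero (by simp [Complex.cpow_eq_zero_iff, hpi]) (Finset.prod_ne_zero_iff.2 ?_)
  intro j hj
  refine Complex.Gamma_ne_zero_of_re_pos ?_
  have h1 := ha j (Finset.mem_range.1 hj)
  have h2 : ((j : ℂ) / 2).re = (j : ℝ) / 2 := by
    rw [show (j : ℂ) / 2 = (((j : ℝ) / 2 : ℝ) : ℂ) by push_cast; rfl, Complex.ofReal_re]
  rw [Complex.sub_re, h2]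
  linarith

/-- The integrand `|X| ^ (a - (p + 1)/2) exp (- tr X)` of the matrix-variate gamma function. -/
def gammaIntegrand (p : ℕ) (a : ℂ) (x : UpperIdx p → ℝ) : ℂ :=
  coneKernel p a x * Complex.exp (-((symmOfUpper p x).trace : ℂ))

theorem measurable_gammaIntegrand (p : ℕ) (a : ℂ) : Measurable (gammaIntegrand p a) :=
  (measurable_coneKernel p a).mul (Complex.measurable_ofReal.comp
    ((measurable_trace_matrix p).comp (measurable_symmOfUpper p))).neg.cexp

/-- The factor of the gamma integrand carried by the corner and the first row. -/
def cornerIntegrand (p : ℕ) (a : ℂ) (z : ℝ × (Fin p → ℝ)) : ℂ :=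
  (Set.Ioi 0).indicator (fun x : ℝ => (x : ℂ) ^ (a - ((p : ℂ) + 2) / 2) * Complex.exp (-(x : ℂ))) z.1 *
    ∏ i, Complex.exp (-(1 / (z.1 : ℂ)) * (z.2 i : ℂ) ^ 2)

theorem measurable_cornerIntegrand (p : ℕ) (a : ℂ) : Measurable (cornerIntegrand p a) := by
  refine Measurable.mul ?_ ?_
  · refine (Measurable.indicator ?_ measurableSet_Ioi).comp measurable_fst
    exact (Complex.measurable_ofReal.pow_const _).mul Complex.measurable_ofReal.neg.cexp
  · refine Finset.measurable_fun_prod _ fun i _ => ?_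
    fun_prop

/-- After the shear the determinant is x |W| and the trace is x + tr W + Σ vᵢ²/x, so the variables
separate. The common exponent a - (p+2)/2 is the one belonging to a - 1/2 in size p, matching
`matrixGamma_succ`. -/
theorem gammaIntegrand_blockUpper (p : ℕ) (a : ℂ)
    (z : (ℝ × (Fin p → ℝ)) × (UpperIdx p → ℝ)) :
    gammaIntegrand (p + 1) a (blockUpper p (schurShear p z)) =
      cornerIntegrand p a z.1 * gammaIntegrand p (a - 1 / 2) z.2 := by
  obtain ⟨⟨x, v⟩, W⟩ := z
  have hS := symmOfUpper_blockUpper p x v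
    (upperPart p (Matrix.of fun i j => v i * v j / x) + W) _ rfl
  -- From here on only the bijectivity of the reindexing is used.
  generalize (finSuccEquiv p).trans
    ((Equiv.optionEquivSumPUnit (Fin p)).trans (Equiv.sumComm _ _)) = e at hS
  have hsym : (Matrix.of fun i j => v i * v j / x).IsSymm := by
    ext i j
    simp [mul_comm]
  rw [symmOfUpper_add, symmOfUpper_upperPart hsym] at hS
  simp only [schurShear]
  by_cases hx : 0 < x
  · obtain ⟨hdet, hpos⟩ := posDef_fromBlocks_schur hx v (symmOfUpper p W)
    have hmem : blockUpper p ((x, v), upperPart p (Matrix.of fun i j => v i * v j / x) + W) ∈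
        upperCone (p + 1) ↔ W ∈ upperCone p := by
      simp only [upperCone, Set.mem_ofPred_eq]
      rw [hS, ← hpos]
      constructor
      · intro h
        have := h.submatrix e.symm.injective
        simpa [Matrix.submatrix_submatrix] using this
      · intro h
        exact h.submatrix e.injective
    by_cases hW : W ∈ upperCone p
    · have hW' : 0 < (symmOfUpper p W).det := Matrix.PosDef.det_pos hW
      have htr : (symmOfUpper (p + 1) (blockUpper p
          ((x, v), upperPart p (Matrix.of fun i j => v i * v j / x) + W))).trace =
          x + (symmOfUpper p W).trace + ∑ i, v i ^ 2 / x := by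
        have hte : ∀ M : Matrix (Unit ⊕ Fin p) (Unit ⊕ Fin p) ℝ, (M.submatrix e e).trace = M.trace :=
          fun M => Equiv.sum_comp e fun i => M i i
        rw [hS, hte]
        simp only [Matrix.trace, Matrix.diag, Fintype.sum_sum_type, Matrix.fromBlocks_apply₁₁,
          Matrix.fromBlocks_apply₂₂, Matrix.add_apply, Matrix.of_apply, Matrix.diagonal_apply_eq,
          Finset.sum_add_distrib, Finset.univ_unique, Finset.sum_singleton, pow_two]
        ring
      rw [gammaIntegrand, gammaIntegrand, cornerIntegrand, coneKernel_of_mem _ hW,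
        coneKernel_of_mem _ (hmem.2 hW), htr, hS, Matrix.det_submatrix_equiv_self, hdet,
        Set.indicator_of_mem (Set.mem_Ioi.2 hx), Complex.ofReal_mul,
        Complex.mul_cpow_ofReal_nonneg hx.le hW'.le, ← Complex.exp_sum]
      have e1 : a - (((p + 1 : ℕ) : ℂ) + 1) / 2 = a - ((p : ℂ) + 2) / 2 := by push_cast; ring
      have e2 : a - 1 / 2 - ((p : ℂ) + 1) / 2 = a - ((p : ℂ) + 2) / 2 := by ring
      rw [e1, e2]
      have e3 : Complex.exp (-((x + (symmOfUpper p W).trace + ∑ i, v i ^ 2 / x : ℝ) : ℂ)) =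
          Complex.exp (-(x : ℂ)) * Complex.exp (∑ i, -(1 / (x : ℂ)) * (v i : ℂ) ^ 2) *
            Complex.exp (-((symmOfUpper p W).trace : ℂ)) := by
        rw [← Complex.exp_add, ← Complex.exp_add]
        congr 1
        push_cast
        simp only [← Finset.mul_sum, ← Finset.sum_div]
        ring
      rw [e3]
      ring
    · rw [gammaIntegrand, gammaIntegrand, coneKernel_of_notMem _ hW,
        coneKernel_of_notMem _ fun h => hW (hmem.1 h)]
      ring
  -- For x ≤ 0 both sides vanish, because a positive definite matrix has a positive corner.
  · rw [gammaIntegrand, coneKernel_of_notMem, cornerIntegrand,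
      Set.indicator_of_notMem (by simpa using hx)]
    · ring
    · intro h
      have h0 := Matrix.PosDef.diag_pos (i := e.symm (Sum.inl ())) h
      rw [hS] at h0
      simp at h0
      exact hx h0

/-- The p Gaussian integrals contribute (πx)^(p/2), which raises the exponent of x to a - 1 and
leaves an Euler gamma integrand. -/
theorem integral_cornerIntegrand_row (p : ℕ) (a : ℂ) (x : ℝ) :
    Integrable (fun v => cornerIntegrand p a (x, v)) ∧
    ∫ v, cornerIntegrand p a (x, v) = (Real.pi : ℂ) ^ ((p : ℂ) / 2) *
      (Set.Ioi 0).indicator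
        (fun x : ℝ => ((Real.exp (-x) : ℝ) : ℂ) * (x : ℂ) ^ (a - 1)) x := by
  by_cases hx : 0 < x
  · have hxm := Set.mem_Ioi.2 hx
    have hre : 0 < (1 / (x : ℂ)).re := by
      rw [← Complex.ofReal_one, ← Complex.ofReal_div, Complex.ofReal_re]
      positivity
    simp only [cornerIntegrand, Set.indicator_of_mem hxm]
    refine ⟨(Integrable.fintype_prod (f := fun (_ : Fin p) (y : ℝ) =>
      Complex.exp (-(1 / (x : ℂ)) * (y : ℂ) ^ 2)) fun i =>
        integrable_cexp_neg_mul_sq hre).const_mul _, ?_⟩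
    rw [integral_const_mul, integral_fintype_prod_volume_eq_pow
      (fun y : ℝ => Complex.exp (-(1 / (x : ℂ)) * (y : ℂ) ^ 2)), integral_gaussian_complex hre,
      Fintype.card_fin, ← Complex.cpow_nat_mul, div_div_eq_mul_div, div_one,
      Complex.mul_cpow_ofReal_nonneg Real.pi_pos.le hx.le, Complex.ofReal_exp, Complex.ofReal_neg]
    have hx' : (x : ℂ) ≠ 0 := by exact_mod_cast hx.ne'
    rw [show a - 1 = (a - ((p : ℂ) + 2) / 2) + (p : ℂ) * (1 / 2) by ring,
      Complex.cpow_add _ _ hx', show (p : ℂ) / 2 = (p : ℂ) * (1 / 2) by ring]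
    ring
  · simp [cornerIntegrand, hx]

theorem norm_cornerIntegrand (p : ℕ) (a : ℂ) (z : ℝ × (Fin p → ℝ)) :
    (‖cornerIntegrand p a z‖ : ℂ) = cornerIntegrand p (a.re : ℂ) z := by
  obtain ⟨x, v⟩ := z
  by_cases hx : 0 < x
  · have hxm := Set.mem_Ioi.2 hx
    simp only [cornerIntegrand, Set.indicator_of_mem hxm]
    rw [norm_mul, norm_mul, norm_prod, Complex.norm_cpow_eq_rpow_re_of_pos hx]
    simp only [Complex.norm_exp]
    push_cast
    rw [Complex.ofReal_cpow hx.le]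
    have h : ∀ i, (-(1 / (x : ℂ)) * (v i : ℂ) ^ 2) = ((-(1 / x) * v i ^ 2 : ℝ) : ℂ) := by
      intro i
      push_cast
      ring
    congr 2
    · congr 1
      simp
    · rw [← Complex.ofReal_neg, Complex.ofReal_re]
    · funext i
      rw [h i, Complex.ofReal_re]
  · simp [cornerIntegrand, hx]

theorem integrable_indicator_gamma {a : ℂ} (ha : 0 < a.re) :
    Integrable ((Set.Ioi 0).indicator
        (fun x : ℝ => ((Real.exp (-x) : ℝ) : ℂ) * (x : ℂ) ^ (a - 1))) :=
  (integrable_indicator_iff measurableSet_Ioi).2 (Complex.GammaIntegral_convergent ha)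

theorem integrable_cornerIntegrand (p : ℕ) {a : ℂ} (ha : 0 < a.re) :
    Integrable (cornerIntegrand p a) := by
  refine (integrable_prod_iff (measurable_cornerIntegrand p a).aestronglyMeasurable).2
    ⟨Filter.Eventually.of_forall fun x => (integral_cornerIntegrand_row p a x).1, ?_⟩
  have h : ∀ x : ℝ, ∫ v, ‖cornerIntegrand p a (x, v)‖ =
      (∫ v, cornerIntegrand p (a.re : ℂ) (x, v)).re := by
    intro x
    simp only [← norm_cornerIntegrand, integral_complex_ofReal, Complex.ofReal_re]
  simp only [h, integral_cornerIntegrand_row]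
  exact ((integrable_indicator_gamma (by simpa using ha)).const_mul _).re

theorem integral_cornerIntegrand (p : ℕ) {a : ℂ} (ha : 0 < a.re) :
    ∫ z, cornerIntegrand p a z = (Real.pi : ℂ) ^ ((p : ℂ) / 2) * Complex.Gamma a := by
  rw [Measure.volume_eq_prod, integral_prod _ (integrable_cornerIntegrand p ha)]
  simp only [integral_cornerIntegrand_row]
  rw [integral_const_mul, integral_indicator measurableSet_Ioi, Complex.Gamma_eq_integral ha]
  rfl

theorem gammaIntegrand_integral (p : ℕ) {a : ℂ} (ha : ∀ j < p, (j : ℝ) / 2 < a.re) :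
    Integrable (gammaIntegrand p a) ∧ ∫ x, gammaIntegrand p a x = matrixGamma p a := by
  induction p generalizing a with
  | zero =>
    have h : gammaIntegrand 0 a = fun _ => 1 := by
      funext x
      have hx : x ∈ upperCone 0 := by
        have : symmOfUpper 0 x = 1 := Subsingleton.elim _ _
        rw [upperCone, Set.mem_ofPred_eq, this]
        exact Matrix.PosDef.one
      simp [gammaIntegrand, coneKernel_of_mem _ hx]
    -- For p = 0 there are no coordinates and Lebesgue measure is a unit point mass.
    rw [h, matrixGamma_zero, Measure.volume_pi_eq_dirac (0 : UpperIdx 0 → ℝ)]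
    exact ⟨integrable_const _, by simp⟩
  | succ p ih =>
    have ha' : ∀ j < p, (j : ℝ) / 2 < (a - 1 / 2).re := by
      intro j hj
      have h := ha (j + 1) (Nat.succ_lt_succ hj)
      push_cast at h
      rw [Complex.sub_re, show ((1 : ℂ) / 2).re = 1 / 2 by norm_num]
      linarith
    have ha0 : 0 < a.re := by simpa using ha 0 p.succ_pos
    obtain ⟨hi, he⟩ := ih ha'
    have hmp := (measurePreserving_blockUpper p).comp (measurePreserving_schurShear p)
    have hfun : gammaIntegrand (p + 1) a ∘ (blockUpper p ∘ schurShear p) =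
        fun z => cornerIntegrand p a z.1 * gammaIntegrand p (a - 1 / 2) z.2 :=
      funext (gammaIntegrand_blockUpper p a)
    have hm := (measurable_gammaIntegrand (p + 1) a).aestronglyMeasurable (μ := volume)
    constructor
    · rw [← hmp.integrable_comp hm, hfun]
      exact (integrable_cornerIntegrand p ha0).mul_prod hi
    · rw [← hmp.map_eq] at hm
      rw [← hmp.map_eq, integral_map hmp.measurable.aemeasurable hm]
      have : ∀ z, gammaIntegrand (p + 1) a ((blockUpper p ∘ schurShear p) z) = _ :=
        gammaIntegrand_blockUpper p a
      simp only [this]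
      rw [Measure.volume_eq_prod, integral_prod_mul, he, integral_cornerIntegrand p ha0,
        matrixGamma_succ]

/-! ### The beta integral -/

theorem gammaIntegrand_mul_gammaIntegrand_sub (p : ℕ) (a b : ℂ) (x t : UpperIdx p → ℝ) :
    gammaIntegrand p a x * gammaIntegrand p b (t - x) =
      coneKernel p a x * coneKernel p b (t - x) *
        Complex.exp (-((symmOfUpper p t).trace : ℂ)) := by
  rw [gammaIntegrand, gammaIntegrand, symmOfUpper_sub, Matrix.trace_sub,
    show ∀ u v w z : ℂ, u * v * (w * z) = u * w * (v * z) by intros; ring, ← Complex.exp_add]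
  congr 2
  push_cast
  ring

theorem integrable_gammaIntegrand_mul_sub {p : ℕ} {a b : ℂ} (ha : ∀ j < p, (j : ℝ) / 2 < a.re)
    (hb : ∀ j < p, (j : ℝ) / 2 < b.re) :
    Integrable (fun z : (UpperIdx p → ℝ) × (UpperIdx p → ℝ) =>
      gammaIntegrand p a z.1 * gammaIntegrand p b (z.2 - z.1)) (volume.prod volume) :=
  (measurePreserving_prod_sub volume volume).integrable_comp_of_integrable
    ((gammaIntegrand_integral p ha).1.mul_prod (gammaIntegrand_integral p hb).1)

theorem integral_gammaIntegrand_mul_sub {p : ℕ} {a b : ℂ} (ha : ∀ j < p, (j : ℝ) / 2 < a.re)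
    (hb : ∀ j < p, (j : ℝ) / 2 < b.re) :
    ∫ z : (UpperIdx p → ℝ) × (UpperIdx p → ℝ),
      gammaIntegrand p a z.1 * gammaIntegrand p b (z.2 - z.1) ∂(volume.prod volume) =
        matrixGamma p a * matrixGamma p b := by
  have hmp := measurePreserving_prod_sub (volume : Measure (UpperIdx p → ℝ))
    (volume : Measure (UpperIdx p → ℝ))
  rw [← (gammaIntegrand_integral p ha).2, ← (gammaIntegrand_integral p hb).2, ← integral_prod_mul]
  have hi := (gammaIntegrand_integral p ha).1.mul_prod (gammaIntegrand_integral p hb).1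
  have hm := hi.aestronglyMeasurable
  rw [← hmp.map_eq] at hm
  have := integral_map hmp.measurable.aemeasurable hm
  rw [hmp.map_eq] at this
  exact this.symm

/-- Fubini gives this with an extra factor exp(-tr t), which is a nonzero constant on each slice and
can be divided out. -/
theorem ae_integrable_coneKernel_mul_sub {p : ℕ} {a b : ℂ} (ha : ∀ j < p, (j : ℝ) / 2 < a.re)
    (hb : ∀ j < p, (j : ℝ) / 2 < b.re) :
    ∀ᵐ t : UpperIdx p → ℝ, Integrable fun x => coneKernel p a x * coneKernel p b (t - x) := by
  filter_upwards [(integrable_gammaIntegrand_mul_sub ha hb).prod_left_ae] with t ht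
  simp only [gammaIntegrand_mul_gammaIntegrand_sub] at ht
  have := ht.mul_const (Complex.exp (-((symmOfUpper p t).trace : ℂ)))⁻¹
  simpa only [mul_assoc, mul_inv_cancel₀ (Complex.exp_ne_zero _), mul_one] using this

/-- The matrix-variate beta integral. -/
theorem coneConv_upperOne {p : ℕ} {a b : ℂ} (ha : ∀ j < p, (j : ℝ) / 2 < a.re)
    (hb : ∀ j < p, (j : ℝ) / 2 < b.re) :
    coneConv p a b (upperOne p) * matrixGamma p (a + b) = matrixGamma p a * matrixGamma p b := by
  have hab : ∀ j < p, (j : ℝ) / 2 < (a + b).re := by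
    intro j hj
    have h1 := ha j hj
    have h2 := hb j hj
    have h3 : (0 : ℝ) ≤ j := Nat.cast_nonneg j
    rw [Complex.add_re]
    linarith
  rw [← integral_gammaIntegrand_mul_sub ha hb,
    integral_prod_symm _ (integrable_gammaIntegrand_mul_sub ha hb),
    ← (gammaIntegrand_integral p hab).2, ← integral_const_mul]
  refine integral_congr_ae (Filter.Eventually.of_forall fun t => ?_)
  -- The exponential depends on t alone, so the inner integral is the convolution; by homogeneity
  -- this is a constant times the kernel of a + b.
  simp only [gammaIntegrand_mul_gammaIntegrand_sub, integral_mul_const]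
  rw [gammaIntegrand, ← mul_assoc, ← coneConv]
  congr 1
  by_cases ht : t ∈ upperCone p
  · exact (coneConv_eq a b ht).symm
  · rw [coneConv_of_notMem _ _ ht, coneKernel_of_notMem _ ht, mul_zero]

/-! ### The kernel of the double integral -/

/-- The kernel `|X| ^ (s - (p + 1)/2) |T - X| ^ (α - (p + 1)/2) |T| ^ ((p + 1)/2 - α - s)`. -/
def betaKernel (p : ℕ) (s α : ℂ) (z : (UpperIdx p → ℝ) × (UpperIdx p → ℝ)) : ℂ :=
  coneKernel p s z.1 * coneKernel p α (z.2 - z.1) * coneKernel p ((p : ℂ) + 1 - α - s) z.2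

theorem measurable_betaKernel (p : ℕ) (s α : ℂ) : Measurable (betaKernel p s α) :=
  (((measurable_coneKernel p s).comp measurable_fst).mul ((measurable_coneKernel p α).comp
    (measurable_snd.sub measurable_fst))).mul ((measurable_coneKernel p _).comp measurable_snd)

theorem norm_betaKernel (p : ℕ) (s α : ℂ) (z : (UpperIdx p → ℝ) × (UpperIdx p → ℝ)) :
    (‖betaKernel p s α z‖ : ℂ) = betaKernel p (s.re : ℂ) (α.re : ℂ) z := by
  rw [betaKernel, norm_mul, norm_mul, Complex.ofReal_mul, Complex.ofReal_mul, norm_coneKernel,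
    norm_coneKernel, norm_coneKernel, betaKernel]
  congr 2
  simp

/-- The last factor of the kernel has exponent opposite to that of the convolution, so the
dependence on t cancels. -/
theorem integral_betaKernel {p : ℕ} (s α : ℂ) {t : UpperIdx p → ℝ} (ht : t ∈ upperCone p) :
    ∫ x, betaKernel p s α (x, t) = coneConv p s α (upperOne p) := by
  have hd : ((symmOfUpper p t).det : ℂ) ≠ 0 := by exact_mod_cast (Matrix.PosDef.det_pos ht).ne'
  simp only [betaKernel, integral_mul_const]
  rw [← coneConv, coneConv_eq s α ht, mul_assoc, coneKernel_of_mem _ ht, coneKernel_of_mem _ ht,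
    ← Complex.cpow_add _ _ hd,
    show s + α - ((p : ℂ) + 1) / 2 + ((p : ℂ) + 1 - α - s - ((p : ℂ) + 1) / 2) = 0 by ring,
    Complex.cpow_zero, mul_one]

/-- Tonelli with x integrated first: for t in the cone the inner integral of the modulus is a fixed
multiple of ‖F t‖, and off the cone both are zero. -/
theorem integrable_betaKernel_mul {p : ℕ} {s α : ℂ} (hs : ∀ j < p, (j : ℝ) / 2 < s.re)
    (hα : ∀ j < p, (j : ℝ) / 2 < α.re) {F : (UpperIdx p → ℝ) → ℂ} (hF : Integrable F)
    (hF0 : ∀ t ∉ upperCone p, F t = 0) :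
    Integrable (fun z : (UpperIdx p → ℝ) × (UpperIdx p → ℝ) => betaKernel p s α z * F z.2)
      (volume.prod volume) := by
  have hm : AEStronglyMeasurable (fun z : (UpperIdx p → ℝ) × (UpperIdx p → ℝ) =>
      betaKernel p s α z * F z.2) (volume.prod volume) :=
    (measurable_betaKernel p s α).aestronglyMeasurable.mul
      (hF.aestronglyMeasurable.comp_snd (μ := volume))
  refine (integrable_prod_iff' hm).2 ⟨?_, ?_⟩
  · filter_upwards [ae_integrable_coneKernel_mul_sub hs hα] with t ht
    exact (ht.mul_const (coneKernel p ((p : ℂ) + 1 - α - s) t)).mul_const (F t)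
  · refine (hF.norm.const_mul (coneConv p (s.re : ℂ) (α.re : ℂ) (upperOne p)).re).congr
      (Filter.Eventually.of_forall fun t => ?_)
    simp only [norm_mul, integral_mul_const]
    by_cases ht : t ∈ upperCone p
    · rw [← integral_betaKernel _ _ ht]
      simp only [← norm_betaKernel, integral_complex_ofReal, Complex.ofReal_re]
    · simp [hF0 t ht]

/-! ### The transforms in free coordinates -/

theorem mTransformExists_iff {p : ℕ} (f : Matrix (Fin p) (Fin p) ℝ → ℂ) (s : ℂ) :
    MTransformExists f s ↔
      Integrable ((upperCone p).indicator fun x => mIntegrand f s (symmOfUpper p x)) := by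
  rw [MTransformExists, symmVolume, (measurableEmbedding_symmOfUpper p).integrableOn_map_iff,
    integrable_indicator_iff (measurableSet_upperCone p)]
  rfl

theorem mTransform_eq {p : ℕ} (f : Matrix (Fin p) (Fin p) ℝ → ℂ) (s : ℂ) :
    mTransform f s =
      ∫ x, (upperCone p).indicator (fun x => mIntegrand f s (symmOfUpper p x)) x := by
  rw [mTransform, symmVolume, (measurableEmbedding_symmOfUpper p).setIntegral_map,
    integral_indicator (measurableSet_upperCone p)]
  rfl

theorem measurableSet_sub_mem_upperCone {p : ℕ} (x : UpperIdx p → ℝ) :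
    MeasurableSet {t | t - x ∈ upperCone p} :=
  (measurable_id.sub measurable_const) (measurableSet_upperCone p)

theorem weylExistsAt_iff {p : ℕ} (α : ℂ) (g : Matrix (Fin p) (Fin p) ℝ → ℂ)
    (x : UpperIdx p → ℝ) :
    WeylExistsAt α g (symmOfUpper p x) ↔
      Integrable fun t => coneKernel p α (t - x) * g (symmOfUpper p t) := by
  have h : (fun t => coneKernel p α (t - x) * g (symmOfUpper p t)) =
      {t | t - x ∈ upperCone p}.indicator
        fun t => weylIntegrand α g (symmOfUpper p x) (symmOfUpper p t) := by
    funext t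
    by_cases ht : t - x ∈ upperCone p
    · rw [Set.indicator_of_mem (by exact ht), coneKernel_of_mem _ ht]
      rfl
    · rw [Set.indicator_of_notMem (by exact ht), coneKernel_of_notMem _ ht, zero_mul]
  rw [WeylExistsAt, symmVolume, (measurableEmbedding_symmOfUpper p).integrableOn_map_iff, h,
    integrable_indicator_iff (measurableSet_sub_mem_upperCone x)]
  rfl

theorem weyl_symmOfUpper {p : ℕ} (α : ℂ) (g : Matrix (Fin p) (Fin p) ℝ → ℂ)
    (x : UpperIdx p → ℝ) :
    weyl α g (symmOfUpper p x) =
      1 / matrixGamma p α * ∫ t, coneKernel p α (t - x) * g (symmOfUpper p t) := by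
  have h : (fun t => coneKernel p α (t - x) * g (symmOfUpper p t)) =
      {t | t - x ∈ upperCone p}.indicator
        fun t => weylIntegrand α g (symmOfUpper p x) (symmOfUpper p t) := by
    funext t
    by_cases ht : t - x ∈ upperCone p
    · rw [Set.indicator_of_mem (by exact ht), coneKernel_of_mem _ ht]
      rfl
    · rw [Set.indicator_of_notMem (by exact ht), coneKernel_of_notMem _ ht, zero_mul]
  rw [weyl, symmVolume, (measurableEmbedding_symmOfUpper p).setIntegral_map, h,
    integral_indicator (measurableSet_sub_mem_upperCone x)]
  rfl

/-- The factors in x and t - x confine both sides to O < X < T, where T is itself in the cone and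
powers of |T| may be combined; values of f off the cone play no role. -/
theorem betaKernel_mul_mIntegrand {p : ℕ} (s α : ℂ) (f : Matrix (Fin p) (Fin p) ℝ → ℂ)
    (x t : UpperIdx p → ℝ) :
    betaKernel p s α (x, t) *
        (upperCone p).indicator (fun t => mIntegrand f s (symmOfUpper p t)) t =
      coneKernel p s x * (coneKernel p α (t - x) * detPowMul α f (symmOfUpper p t)) := by
  by_cases hx : x ∈ upperCone p
  · by_cases htx : t - x ∈ upperCone p
    · have ht : t ∈ upperCone p := by simpa using upperCone_add hx htx
      have hd : ((symmOfUpper p t).det : ℂ) ≠ 0 := by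
        exact_mod_cast (Matrix.PosDef.det_pos ht).ne'
      rw [Set.indicator_of_mem ht, betaKernel, mIntegrand, detPowMul]
      simp only
      rw [coneKernel_of_mem _ ht, show -α = ((p : ℂ) + 1 - α - s - ((p : ℂ) + 1) / 2) +
        (s - ((p : ℂ) + 1) / 2) by ring, Complex.cpow_add _ _ hd]
      ring
    · simp [betaKernel, coneKernel_of_notMem _ htx]
  · simp [betaKernel, coneKernel_of_notMem _ hx]

theorem indicator_mIntegrand_weyl {p : ℕ} (s α : ℂ) (f : Matrix (Fin p) (Fin p) ℝ → ℂ)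
    (x : UpperIdx p → ℝ) :
    (upperCone p).indicator
        (fun x => mIntegrand (weyl α (detPowMul α f)) s (symmOfUpper p x)) x =
      1 / matrixGamma p α * ∫ t, betaKernel p s α (x, t) *
        (upperCone p).indicator (fun t => mIntegrand f s (symmOfUpper p t)) t := by
  simp only [betaKernel_mul_mIntegrand, integral_const_mul]
  by_cases hx : x ∈ upperCone p
  · rw [Set.indicator_of_mem hx, mIntegrand, weyl_symmOfUpper, coneKernel_of_mem _ hx]
    ring
  · rw [Set.indicator_of_notMem hx, coneKernel_of_notMem _ hx]
    ring

end

/-! ### The transform of the Weyl integral -/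

theorem corollary3p1p1 (p : ℕ) (α s : ℂ)
    (hα : ((p : ℝ) - 1) / 2 < α.re) (hs : ((p : ℝ) - 1) / 2 < s.re)
    (f : Matrix (Fin p) (Fin p) ℝ → ℂ) (hf : MTransformExists f s) :
    (∀ᵐ X ∂((symmVolume p).restrict (posDefCone p)), WeylExistsAt α (detPowMul α f) X) ∧
      MTransformExists (weyl α (detPowMul α f)) s ∧
      mTransform (weyl α (detPowMul α f)) s =
        matrixGamma p s / matrixGamma p (α + s) * mTransform f s := by
  have hbound : ∀ {a : ℂ}, ((p : ℝ) - 1) / 2 < a.re → ∀ j < p, (j : ℝ) / 2 < a.re := by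
    intro a ha j hj
    have h : (j : ℝ) + 1 ≤ p := by exact_mod_cast hj
    linarith
  have hα' := hbound hα
  have hs' := hbound hs
  have hαs : ∀ j < p, (j : ℝ) / 2 < (s + α).re := by
    intro j hj
    have h1 := hα' j hj
    have h2 := hs' j hj
    have h3 : (0 : ℝ) ≤ j := Nat.cast_nonneg j
    rw [Complex.add_re]
    linarith
  have hF := (mTransformExists_iff f s).1 hf
  have hH := integrable_betaKernel_mul hs' hα' hF fun t ht => Set.indicator_of_notMem ht _
  refine ⟨?_, ?_, ?_⟩
  · rw [symmVolume, (measurableEmbedding_symmOfUpper p).restrict_map,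
      (measurableEmbedding_symmOfUpper p).ae_map_iff]
    change ∀ᵐ x ∂MeasureTheory.volume.restrict (upperCone p), _
    rw [MeasureTheory.ae_restrict_iff' (measurableSet_upperCone p)]
    filter_upwards [hH.prod_right_ae] with x hx hxC
    simp only [betaKernel_mul_mIntegrand] at hx
    rw [weylExistsAt_iff]
    -- Almost every slice of the double integral converges; dividing by the nonzero power of |X|
    -- leaves the Weyl integral.
    have h := hx.const_mul (coneKernel p s x)⁻¹
    simpa only [← mul_assoc, inv_mul_cancel₀ (coneKernel_ne_zero s hxC), one_mul] using h
  · rw [mTransformExists_iff, funext (indicator_mIntegrand_weyl s α f)]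
    exact hH.integral_prod_left.const_mul _
  · rw [mTransform_eq, mTransform_eq, funext (indicator_mIntegrand_weyl s α f), MeasureTheory.integral_const_mul,
      MeasureTheory.integral_integral_swap hH]
    -- With the order of integration swapped, the inner integral is the beta constant times the
    -- integrand of f^*(s).
    have h : ∀ t, ∫ x, betaKernel p s α (x, t) *
        (upperCone p).indicator (fun t => mIntegrand f s (symmOfUpper p t)) t =
        coneConv p s α (upperOne p) *
          (upperCone p).indicator (fun t => mIntegrand f s (symmOfUpper p t)) t := by
      intro t
      rw [MeasureTheory.integral_mul_const]
      by_cases ht : t ∈ upperCone p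
      · rw [integral_betaKernel _ _ ht]
      · rw [Set.indicator_of_notMem ht, mul_zero, mul_zero]
    simp only [h]
    rw [MeasureTheory.integral_const_mul, ← mul_assoc, add_comm α s]
    congr 1
    have h1 := matrixGamma_ne_zero hα'
    have h2 := matrixGamma_ne_zero hαs
    rw [eq_div_iff h2, mul_assoc, coneConv_upperOne hs' hα']
    field_simp
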